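/- **Theorem (Consistency of speculative execution).** *Language.* Values are numbers $n\in\mathbb N$, Booleans, and arrays $a$ with a base address $\mathrm{base}(a)\in\mathbb N$, a length $\mathrm{length}(a)\in\mathbb N$ and an (inert) security label. Expressions are values, variables, $e+e$, $e<e$, $e\otimes e$ (where $\otimes$ is an arbitrary fixed binary operation on numbers, such as a bitwise AND), $e\,?\,e:e$, $\mathrm{length}(e)$ and $\mathrm{base}(e)$. Right-hand sides are $r::=e\mid {*e}\mid a[e]$, and commands are $c::=\mathsf{skip}\mid\mathsf{fail}\mid x:=r\mid {*e}:=e\mid a[e]:=e\mid x:=\mathsf{protect}(r)\mid\mathsf{if}\ e\ \mathsf{then}\ c\ \mathsf{else}\ c\mid\mathsf{while}\ e\ \mathsf{do}\ c\mid c;c$. A memory $\mu$ is a partial map from $\mathbb N$ to values, a variable map $\rho$ is a total map from variables to values. Evaluation $[\![e]\!]^\rho$ is undefined on ill-typed or undefined operands. *Sequential semantics.* $\langle\mu,\rho\rangle\Downarrow^c_O\langle\mu',\rho'\rangle$ is the usual big-step semantics, where $O$ lists, in order, $\mathsf{read}(n)$ for each memory read at address $n$, $\mathsf{write}(n)$ for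 each memory write at $n$, and $\mathsf{fail}$ if the program aborts. An array access with index $n$ (a number) accesses address $\mathrm{base}(a)+n$ if $n<\mathrm{length}(a)$ and aborts otherwise; $x:=\mathsf{protect}(r)$ behaves like $x:=r$; after an abort nothing else is executed. Evaluating an undefined expression or reading an undefined address has no derivation. *Speculative semantics.* A configuration $\langle is,cs,\mu,\rho\rangle$ consists of a reorder buffer $is$ (a list of instructions $\mathsf{nop}$, $\mathsf{fail}(p)$, $x:=e$, $x:=\mathsf{load}(e)$, $\mathsf{store}(e,e)$, $x:=\mathsf{protect}(e)$, $\mathsf{guard}(e^b,cs,p)$ with $b$ a Boolean and $p\in\mathbb N$), a stack $cs$ of commands, a memory and a variable map. It steps under directives, generating observations $\epsilon$ (silent), $\mathsf{fail}(p)$, $\mathsf{read}(n,ps)$, $\mathsf{write}(n,ps)$ or $\mathsf{rollback}(p)$: - $\mathsf{fetch}$ pops the top command (silently): $\mathsf{skip}$, $\mathsf{fail}$, $x:=e$, $x:={*e}$, ${*e_1}:=e_2$, $x:=\mathsf{protect}(e)$ append, respectively, $\mathsf{nop}$, $\mathsf{fail}(p)$ with $p$ fresh (not generated before in the execution), $x:=e$,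 $x:=\mathsf{load}(e)$, $\mathsf{store}(e_1,e_2)$, $x:=\mathsf{protect}(e)$ to the buffer; $c_1;c_2$ is replaced by $c_1$ followed by $c_2$ on the stack; $\mathsf{while}\ e\ \mathsf{do}\ c$ by $\mathsf{if}\ e\ \mathsf{then}\ (c;\mathsf{while}\ e\ \mathsf{do}\ c)\ \mathsf{else}\ \mathsf{skip}$; $x:=a[e]$ by $\mathsf{if}\ e<\mathrm{length}(a)\ \mathsf{then}\ x:={*(\mathrm{base}(a)+e)}\ \mathsf{else}\ \mathsf{fail}$; $a[e_1]:=e_2$ by $\mathsf{if}\ e_1<\mathrm{length}(a)\ \mathsf{then}\ {*(\mathrm{base}(a)+e_1)}:=e_2\ \mathsf{else}\ \mathsf{fail}$; and $x:=\mathsf{protect}(r)$, for $r$ not an expression, by $x:=r$ followed by $x:=\mathsf{protect}(x)$. - $\mathsf{fetch}\ b$ applies when the top command is a conditional with condition $e$: it silently replaces it by the branch for $b$ and appends $\mathsf{guard}(e^b,c:cs,p)$, where $c$ is the other branch, $cs$ the rest of the stack and $p$ is fresh. - $\mathsf{exec}\ n$ splits the buffer as $is_1+[i]+is_2$ with $|is_1|=n-1$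 and executes $i$ under the transient variable map obtained from $\rho$ by going through $is_1$, where each assignment $x:=v$ of a value sets $x$ to $v$, and each other pending assignment, load or protect to $x$ makes $x$ undefined. All operands must evaluate to defined values (addresses to numbers, conditions to Booleans). Let $ps$ list the identifiers of the guard and fail instructions in $is_1$. An assignment $x:=e$ becomes $x:=v$, with $v$ the value of $e$. A load of address $n'$ requires that $is_1$ contains no store and $\mu(n')$ is defined, becomes $x:=\mu(n')$ and is observed as $\mathsf{read}(n',ps)$. A store becomes $\mathsf{store}(n',v)$, with the values of its operands, and is observed as $\mathsf{write}(n',ps)$. $x:=\mathsf{protect}(e)$ becomes $x:=\mathsf{protect}(v)$, and $x:=\mathsf{protect}(v)$ becomes $x:=v$ if $is_1$ contains no guard. A guard whose condition evaluates to $b$ becomes $\mathsf{nop}$; otherwise the new buffer is $is_1+[\mathsf{nop}]$, the stack recorded in the guard replaces the command stack, and $\mathsf{rollback}(p)$ is observed. All other executions are silent. - $\mathsf{retire}$ removes the first instruction of the buffer, which must be $\mathsf{nop}$, $x:=v$ (updating $\rho$), $\mathsf{store}(n,v)$ (updating $\mu$), or $\mathsf{fail}(p)$ (emptying buffer and stack,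 observed as $\mathsf{fail}(p)$). A schedule $D$ is a list of directives. $C\Downarrow^D_{O}C'$ denotes a complete execution from $C$ that follows $D$, generates the list of observations $O$ and ends in a configuration $C'$ with empty buffer and empty stack. The execution is *valid* if every fetched instruction is executed at most once (a protect instruction: at most twice, once for each of its two stages) and no store retires without having been executed. *Filtering.* For a speculative trace $O$, let $P$ be the set of all $p$ such that $\mathsf{rollback}(p)$ or $\mathsf{fail}(p)$ occurs in $O$. The trace $O{\downarrow}$ is obtained from $O$ by deleting silent observations, rollbacks, and all $\mathsf{read}(n,ps)$ and $\mathsf{write}(n,ps)$ such that $ps$ contains an element of $P$, and by replacing the remaining observations by $\mathsf{read}(n)$, $\mathsf{write}(n)$ and $\mathsf{fail}$. *Claim.* For all commands $c$, memories $\mu$, variable maps $\rho$ and schedules $D$: if $\langle\mu,\rho\rangle\Downarrow^c_O\langle\mu',\rho'\rangle$ and $\langle[\,],[c],\mu,\rho\rangle\Downarrow^D_{O'}\langle[\,],[\,],\mu'',\rho''\rangle$ by a valid execution, then $\mu'=\mu''$, $\rho'=\rho''$, and $O$ is a permutation of $O'{\downarrow}$. -/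

import Mathlib

namespace SpecSem

/-! ### Source language -/

/-- Security labels. They decorate arrays and memory accesses and do not influence execution. -/
inductive Label where
  | low
  | high

/-- Arrays: base address, length and security label. -/
structure Arr where
  base : ℕ
  length : ℕ
  label : Label

inductive Value where
  | num (n : ℕ)
  | bool (b : Bool)
  | arr (a : Arr)

inductive Expr (Var : Type*) where
  | val (v : Value)
  | var (x : Var)
  | add (e₁ e₂ : Expr Var)
  | lt (e₁ e₂ : Expr Var)
  | band (e₁ e₂ : Expr Var)
  | ite (e₁ e₂ e₃ : Expr Var)
  | length (e : Expr Var)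
  | base (e : Expr Var)

/-- Right-hand sides: expressions, pointer reads `*e`, array reads `a[e]`. -/
inductive Rhs (Var : Type*) where
  | expr (e : Expr Var)
  | ptr (l : Label) (e : Expr Var)
  | arr (a : Arr) (e : Expr Var)

inductive Cmd (Var : Type*) where
  | skip
  | fail
  | asgn (x : Var) (r : Rhs Var)
  | ptrWrite (l : Label) (e₁ e₂ : Expr Var)
  | arrWrite (a : Arr) (e₁ e₂ : Expr Var)
  | protect (x : Var) (r : Rhs Var)
  | ite (e : Expr Var) (c₁ c₂ : Cmd Var)
  | while (e : Expr Var) (c : Cmd Var)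
  | seq (c₁ c₂ : Cmd Var)

/-- Memory stores are partial maps from addresses to values. -/
abbrev Mem := ℕ → Option Value

/-- Variable maps are total. -/
abbrev VarMap (Var : Type*) := Var → Value

/-- Transient variable maps; `none` is the undefined value of a variable whose assignment is
still pending. -/
abbrev TVarMap (Var : Type*) := Var → Option Value

/-- A variable map seen as a transient variable map that is defined everywhere. -/
def VarMap.lift {Var : Type*} (ρ : VarMap Var) : TVarMap Var := fun x => some (ρ x)

/-- Value of an expression, `none` when undefined. The bitwise operator on numbers is the
parameter `band`, because no size or bit representation of numbers is fixed. -/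
def eval {Var : Type*} (band : ℕ → ℕ → ℕ) (ρ : TVarMap Var) : Expr Var → Option Value
  | .val v => some v
  | .var x => ρ x
  | .add e₁ e₂ =>
    match eval band ρ e₁, eval band ρ e₂ with
    | some (.num m), some (.num n) => some (.num (m + n))
    | _, _ => none
  | .lt e₁ e₂ =>
    match eval band ρ e₁, eval band ρ e₂ with
    | some (.num m), some (.num n) => some (.bool (decide (m < n)))
    | _, _ => none
  | .band e₁ e₂ =>
    match eval band ρ e₁, eval band ρ e₂ with
    | some (.num m), some (.num n) => some (.num (band m n))
    | _, _ => none
  | .ite e₁ e₂ e₃ =>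
    match eval band ρ e₁ with
    | some (.bool true) => eval band ρ e₂
    | some (.bool false) => eval band ρ e₃
    | _ => none
  | .length e =>
    match eval band ρ e with
    | some (.arr a) => some (.num a.length)
    | _ => none
  | .base e =>
    match eval band ρ e with
    | some (.arr a) => some (.num a.base)
    | _ => none

/-! ### Sequential big-step semantics -/

/-- Observations of a sequential execution. The silent observation is left out of sequential
traces: a silent trace is `[]`. -/
inductive SeqObs where
  | fail
  | read (n : ℕ)
  | write (n : ℕ)

/-- `SeqEval band c μ ρ O μ' ρ'`: the program `c` takes `⟨μ, ρ⟩` to `⟨μ', ρ'⟩` with trace `O`. -/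
inductive SeqEval {Var : Type*} [DecidableEq Var] (band : ℕ → ℕ → ℕ) :
    Cmd Var → Mem → VarMap Var → List SeqObs → Mem → VarMap Var → Prop where
  | skip {μ : Mem} {ρ : VarMap Var} : SeqEval band .skip μ ρ [] μ ρ
  | fail {μ : Mem} {ρ : VarMap Var} : SeqEval band .fail μ ρ [.fail] μ ρ
  | asgn {μ : Mem} {ρ : VarMap Var} {x : Var} {e : Expr Var} {v : Value} :
      eval band ρ.lift e = some v →
      SeqEval band (.asgn x (.expr e)) μ ρ [] μ (Function.update ρ x v)
  | protect {μ : Mem} {ρ ρ' : VarMap Var} {x : Var} {r : Rhs Var} {O : List SeqObs} :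
      SeqEval band (.asgn x r) μ ρ O μ ρ' →
      SeqEval band (.protect x r) μ ρ O μ ρ'
  | ptrRead {μ : Mem} {ρ : VarMap Var} {x : Var} {l : Label} {e : Expr Var} {n : ℕ}
      {v : Value} :
      eval band ρ.lift e = some (.num n) → μ n = some v →
      SeqEval band (.asgn x (.ptr l e)) μ ρ [.read n] μ (Function.update ρ x v)
  | arrRead {μ : Mem} {ρ : VarMap Var} {x : Var} {a : Arr} {e : Expr Var} {n : ℕ} {v : Value} :
      eval band ρ.lift e = some (.num n) → n < a.length → μ (a.base + n) = some v →
      SeqEval band (.asgn x (.arr a e)) μ ρ [.read (a.base + n)] μ (Function.update ρ x v)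
  | arrReadFail {μ : Mem} {ρ : VarMap Var} {x : Var} {a : Arr} {e : Expr Var} {n : ℕ} :
      eval band ρ.lift e = some (.num n) → a.length ≤ n →
      SeqEval band (.asgn x (.arr a e)) μ ρ [.fail] μ ρ
  | ptrWrite {μ : Mem} {ρ : VarMap Var} {l : Label} {e₁ e₂ : Expr Var} {n : ℕ} {v : Value} :
      eval band ρ.lift e₁ = some (.num n) → eval band ρ.lift e₂ = some v →
      SeqEval band (.ptrWrite l e₁ e₂) μ ρ [.write n] (Function.update μ n (some v)) ρ
  | arrWrite {μ : Mem} {ρ : VarMap Var} {a : Arr} {e₁ e₂ : Expr Var} {n : ℕ} {v : Value} :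
      eval band ρ.lift e₁ = some (.num n) → eval band ρ.lift e₂ = some v → n < a.length →
      SeqEval band (.arrWrite a e₁ e₂) μ ρ [.write (a.base + n)]
        (Function.update μ (a.base + n) (some v)) ρ
  | arrWriteFail {μ : Mem} {ρ : VarMap Var} {a : Arr} {e₁ e₂ : Expr Var} {n : ℕ} :
      eval band ρ.lift e₁ = some (.num n) → a.length ≤ n →
      SeqEval band (.arrWrite a e₁ e₂) μ ρ [.fail] μ ρ
  | ite {μ μ' : Mem} {ρ ρ' : VarMap Var} {e : Expr Var} {c₁ c₂ : Cmd Var} {b : Bool}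
      {O : List SeqObs} :
      eval band ρ.lift e = some (.bool b) →
      SeqEval band (if b then c₁ else c₂) μ ρ O μ' ρ' →
      SeqEval band (.ite e c₁ c₂) μ ρ O μ' ρ'
  | whileTrue {μ μ' : Mem} {ρ ρ' : VarMap Var} {e : Expr Var} {c : Cmd Var}
      {O : List SeqObs} :
      eval band ρ.lift e = some (.bool true) →
      SeqEval band (.seq c (.while e c)) μ ρ O μ' ρ' →
      SeqEval band (.while e c) μ ρ O μ' ρ'
  | whileFalse {μ : Mem} {ρ : VarMap Var} {e : Expr Var} {c : Cmd Var} :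
      eval band ρ.lift e = some (.bool false) →
      SeqEval band (.while e c) μ ρ [] μ ρ
  | seq {μ μ' μ'' : Mem} {ρ ρ' ρ'' : VarMap Var} {c₁ c₂ : Cmd Var} {O₁ O₂ : List SeqObs} :
      SeqEval band c₁ μ ρ O₁ μ' ρ' → SeqObs.fail ∉ O₁ →
      SeqEval band c₂ μ' ρ' O₂ μ'' ρ'' →
      SeqEval band (.seq c₁ c₂) μ ρ (O₁ ++ O₂) μ'' ρ''
  | seqFail {μ μ' : Mem} {ρ ρ' : VarMap Var} {c₁ c₂ : Cmd Var} {O₁ : List SeqObs} :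
      SeqEval band c₁ μ ρ O₁ μ' ρ' → SeqObs.fail ∈ O₁ →
      SeqEval band (.seq c₁ c₂) μ ρ O₁ μ' ρ'

/-! ### Processor -/

/-- Instructions. An assignment or store whose operands are values is *resolved*. -/
inductive Instr (Var : Type*) where
  | nop
  | fail (p : ℕ)
  | asgn (x : Var) (e : Expr Var)
  | load (x : Var) (l : Label) (e : Expr Var)
  | store (l : Label) (e₁ e₂ : Expr Var)
  | protect (x : Var) (e : Expr Var)
  | guard (e : Expr Var) (b : Bool) (cs : List (Cmd Var)) (p : ℕ)

def Instr.IsStore {Var : Type*} : Instr Var → Prop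
  | .store _ _ _ => True
  | _ => False

def Instr.IsGuard {Var : Type*} : Instr Var → Prop
  | .guard _ _ _ _ => True
  | _ => False

inductive Directive where
  | fetch
  | fetchBr (b : Bool)
  | exec (n : ℕ)
  | retire

inductive Obs where
  | silent
  | fail (p : ℕ)
  | read (n : ℕ) (ps : List ℕ)
  | write (n : ℕ) (ps : List ℕ)
  | rollback (p : ℕ)

/-- Configurations: reorder buffer, command stack, memory, variable map. The last component
records the guard and fail identifiers generated so far in the execution; an identifier is
fresh when it does not belong to it. -/
structure Config (Var : Type*) where
  buf : List (Instr Var)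
  stack : List (Cmd Var)
  mem : Mem
  vars : VarMap Var
  used : Finset ℕ

/-- The transient variable map: pending resolved assignments are applied, and the targets of the
pending unresolved ones become undefined. -/
def transient {Var : Type*} [DecidableEq Var] (ρ : TVarMap Var) : List (Instr Var) → TVarMap Var
  | [] => ρ
  | .asgn x (.val v) :: is => transient (Function.update ρ x (some v)) is
  | .asgn x _ :: is => transient (Function.update ρ x none) is
  | .load x _ _ :: is => transient (Function.update ρ x none) is
  | .protect x _ :: is => transient (Function.update ρ x none) is
  | _ :: is => transient ρ is

/-- Identifiers of the pending guard and fail instructions. -/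
def pendingIds {Var : Type*} : List (Instr Var) → List ℕ
  | [] => []
  | .guard _ _ _ p :: is => p :: pendingIds is
  | .fail p :: is => p :: pendingIds is
  | _ :: is => pendingIds is

/-- `ExecInstr band μ ρ is₁ i is₂ cs o is' cs'`: with memory `μ` and transient variable map `ρ`,
executing `i` in the buffer `is₁ ++ [i] ++ is₂` with command stack `cs` yields the buffer `is'`,
the command stack `cs'` and the observation `o`. -/
inductive ExecInstr {Var : Type*} (band : ℕ → ℕ → ℕ) (μ : Mem) (ρ : TVarMap Var) :
    List (Instr Var) → Instr Var → List (Instr Var) → List (Cmd Var) → Obs →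
    List (Instr Var) → List (Cmd Var) → Prop where
  | asgn {is₁ is₂ : List (Instr Var)} {cs : List (Cmd Var)} {x : Var} {e : Expr Var}
      {v : Value} :
      eval band ρ e = some v →
      ExecInstr band μ ρ is₁ (.asgn x e) is₂ cs .silent
        (is₁ ++ [.asgn x (.val v)] ++ is₂) cs
  | load {is₁ is₂ : List (Instr Var)} {cs : List (Cmd Var)} {x : Var} {l : Label}
      {e : Expr Var} {n : ℕ} {v : Value} :
      (∀ i ∈ is₁, ¬ i.IsStore) → eval band ρ e = some (.num n) → μ n = some v →
      ExecInstr band μ ρ is₁ (.load x l e) is₂ cs (.read n (pendingIds is₁))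
        (is₁ ++ [.asgn x (.val v)] ++ is₂) cs
  | store {is₁ is₂ : List (Instr Var)} {cs : List (Cmd Var)} {l : Label} {e₁ e₂ : Expr Var}
      {n : ℕ} {v : Value} :
      eval band ρ e₁ = some (.num n) → eval band ρ e₂ = some v →
      ExecInstr band μ ρ is₁ (.store l e₁ e₂) is₂ cs (.write n (pendingIds is₁))
        (is₁ ++ [.store l (.val (.num n)) (.val v)] ++ is₂) cs
  | branchOk {is₁ is₂ : List (Instr Var)} {cs cs' : List (Cmd Var)} {e : Expr Var} {b : Bool}
      {p : ℕ} :
      eval band ρ e = some (.bool b) →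
      ExecInstr band μ ρ is₁ (.guard e b cs' p) is₂ cs .silent (is₁ ++ [.nop] ++ is₂) cs
  | branchMispredict {is₁ is₂ : List (Instr Var)} {cs cs' : List (Cmd Var)} {e : Expr Var}
      {b b' : Bool} {p : ℕ} :
      eval band ρ e = some (.bool b') → b' ≠ b →
      ExecInstr band μ ρ is₁ (.guard e b cs' p) is₂ cs (.rollback p) (is₁ ++ [.nop]) cs'
  | protect₁ {is₁ is₂ : List (Instr Var)} {cs : List (Cmd Var)} {x : Var} {e : Expr Var}
      {v : Value} :
      eval band ρ e = some v →
      ExecInstr band μ ρ is₁ (.protect x e) is₂ cs .silent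
        (is₁ ++ [.protect x (.val v)] ++ is₂) cs
  | protect₂ {is₁ is₂ : List (Instr Var)} {cs : List (Cmd Var)} {x : Var} {v : Value} :
      (∀ i ∈ is₁, ¬ i.IsGuard) →
      ExecInstr band μ ρ is₁ (.protect x (.val v)) is₂ cs .silent
        (is₁ ++ [.asgn x (.val v)] ++ is₂) cs

/-- `Step band C d o C'`: one step of the processor from `C` to `C'` under the directive `d`,
with observation `o`. -/
inductive Step {Var : Type*} [DecidableEq Var] (band : ℕ → ℕ → ℕ) :
    Config Var → Directive → Obs → Config Var → Prop where
  -- fetch stage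
  | fetchSkip {is : List (Instr Var)} {cs : List (Cmd Var)} {μ : Mem} {ρ : VarMap Var}
      {U : Finset ℕ} :
      Step band ⟨is, .skip :: cs, μ, ρ, U⟩ .fetch .silent ⟨is ++ [.nop], cs, μ, ρ, U⟩
  | fetchFail {is : List (Instr Var)} {cs : List (Cmd Var)} {μ : Mem} {ρ : VarMap Var}
      {U : Finset ℕ} {p : ℕ} :
      p ∉ U →
      Step band ⟨is, .fail :: cs, μ, ρ, U⟩ .fetch .silent
        ⟨is ++ [.fail p], cs, μ, ρ, insert p U⟩
  | fetchAsgn {is : List (Instr Var)} {cs : List (Cmd Var)} {μ : Mem} {ρ : VarMap Var}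
      {U : Finset ℕ} {x : Var} {e : Expr Var} :
      Step band ⟨is, .asgn x (.expr e) :: cs, μ, ρ, U⟩ .fetch .silent
        ⟨is ++ [.asgn x e], cs, μ, ρ, U⟩
  | fetchSeq {is : List (Instr Var)} {cs : List (Cmd Var)} {μ : Mem} {ρ : VarMap Var}
      {U : Finset ℕ} {c₁ c₂ : Cmd Var} :
      Step band ⟨is, .seq c₁ c₂ :: cs, μ, ρ, U⟩ .fetch .silent ⟨is, c₁ :: c₂ :: cs, μ, ρ, U⟩
  | fetchPtrLoad {is : List (Instr Var)} {cs : List (Cmd Var)} {μ : Mem} {ρ : VarMap Var}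
      {U : Finset ℕ} {x : Var} {l : Label} {e : Expr Var} :
      Step band ⟨is, .asgn x (.ptr l e) :: cs, μ, ρ, U⟩ .fetch .silent
        ⟨is ++ [.load x l e], cs, μ, ρ, U⟩
  | fetchPtrStore {is : List (Instr Var)} {cs : List (Cmd Var)} {μ : Mem} {ρ : VarMap Var}
      {U : Finset ℕ} {l : Label} {e₁ e₂ : Expr Var} :
      Step band ⟨is, .ptrWrite l e₁ e₂ :: cs, μ, ρ, U⟩ .fetch .silent
        ⟨is ++ [.store l e₁ e₂], cs, μ, ρ, U⟩
  | fetchArrLoad {is : List (Instr Var)} {cs : List (Cmd Var)} {μ : Mem} {ρ : VarMap Var}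
      {U : Finset ℕ} {x : Var} {a : Arr} {e : Expr Var} :
      Step band ⟨is, .asgn x (.arr a e) :: cs, μ, ρ, U⟩ .fetch .silent
        ⟨is, .ite (.lt e (.length (.val (.arr a))))
            (.asgn x (.ptr a.label (.add (.base (.val (.arr a))) e))) .fail :: cs, μ, ρ, U⟩
  | fetchArrStore {is : List (Instr Var)} {cs : List (Cmd Var)} {μ : Mem} {ρ : VarMap Var}
      {U : Finset ℕ} {a : Arr} {e₁ e₂ : Expr Var} :
      Step band ⟨is, .arrWrite a e₁ e₂ :: cs, μ, ρ, U⟩ .fetch .silent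
        ⟨is, .ite (.lt e₁ (.length (.val (.arr a))))
            (.ptrWrite a.label (.add (.base (.val (.arr a))) e₁) e₂) .fail :: cs, μ, ρ, U⟩
  | fetchIfTrue {is : List (Instr Var)} {cs : List (Cmd Var)} {μ : Mem} {ρ : VarMap Var}
      {U : Finset ℕ} {e : Expr Var} {c₁ c₂ : Cmd Var} {p : ℕ} :
      p ∉ U →
      Step band ⟨is, .ite e c₁ c₂ :: cs, μ, ρ, U⟩ (.fetchBr true) .silent
        ⟨is ++ [.guard e true (c₂ :: cs) p], c₁ :: cs, μ, ρ, insert p U⟩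
  | fetchIfFalse {is : List (Instr Var)} {cs : List (Cmd Var)} {μ : Mem} {ρ : VarMap Var}
      {U : Finset ℕ} {e : Expr Var} {c₁ c₂ : Cmd Var} {p : ℕ} :
      p ∉ U →
      Step band ⟨is, .ite e c₁ c₂ :: cs, μ, ρ, U⟩ (.fetchBr false) .silent
        ⟨is ++ [.guard e false (c₁ :: cs) p], c₂ :: cs, μ, ρ, insert p U⟩
  | fetchWhile {is : List (Instr Var)} {cs : List (Cmd Var)} {μ : Mem} {ρ : VarMap Var}
      {U : Finset ℕ} {e : Expr Var} {c : Cmd Var} :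
      Step band ⟨is, .while e c :: cs, μ, ρ, U⟩ .fetch .silent
        ⟨is, .ite e (.seq c (.while e c)) .skip :: cs, μ, ρ, U⟩
  | fetchProtectExpr {is : List (Instr Var)} {cs : List (Cmd Var)} {μ : Mem} {ρ : VarMap Var}
      {U : Finset ℕ} {x : Var} {e : Expr Var} :
      Step band ⟨is, .protect x (.expr e) :: cs, μ, ρ, U⟩ .fetch .silent
        ⟨is ++ [.protect x e], cs, μ, ρ, U⟩
  | fetchProtectPtr {is : List (Instr Var)} {cs : List (Cmd Var)} {μ : Mem} {ρ : VarMap Var}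
      {U : Finset ℕ} {x : Var} {l : Label} {e : Expr Var} :
      Step band ⟨is, .protect x (.ptr l e) :: cs, μ, ρ, U⟩ .fetch .silent
        ⟨is, .asgn x (.ptr l e) :: .protect x (.expr (.var x)) :: cs, μ, ρ, U⟩
  | fetchProtectArr {is : List (Instr Var)} {cs : List (Cmd Var)} {μ : Mem} {ρ : VarMap Var}
      {U : Finset ℕ} {x : Var} {a : Arr} {e : Expr Var} :
      Step band ⟨is, .protect x (.arr a e) :: cs, μ, ρ, U⟩ .fetch .silent
        ⟨is, .asgn x (.arr a e) :: .protect x (.expr (.var x)) :: cs, μ, ρ, U⟩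
  -- execute stage
  | execute {is₁ is₂ is' : List (Instr Var)} {i : Instr Var} {cs cs' : List (Cmd Var)}
      {μ : Mem} {ρ : VarMap Var} {U : Finset ℕ} {n : ℕ} {o : Obs} :
      is₁.length + 1 = n →
      ExecInstr band μ (transient ρ.lift is₁) is₁ i is₂ cs o is' cs' →
      Step band ⟨is₁ ++ [i] ++ is₂, cs, μ, ρ, U⟩ (.exec n) o ⟨is', cs', μ, ρ, U⟩
  -- retire stage
  | retireNop {is : List (Instr Var)} {cs : List (Cmd Var)} {μ : Mem} {ρ : VarMap Var}
      {U : Finset ℕ} :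
      Step band ⟨.nop :: is, cs, μ, ρ, U⟩ .retire .silent ⟨is, cs, μ, ρ, U⟩
  | retireAsgn {is : List (Instr Var)} {cs : List (Cmd Var)} {μ : Mem} {ρ : VarMap Var}
      {U : Finset ℕ} {x : Var} {v : Value} :
      Step band ⟨.asgn x (.val v) :: is, cs, μ, ρ, U⟩ .retire .silent
        ⟨is, cs, μ, Function.update ρ x v, U⟩
  | retireStore {is : List (Instr Var)} {cs : List (Cmd Var)} {μ : Mem} {ρ : VarMap Var}
      {U : Finset ℕ} {l : Label} {n : ℕ} {v : Value} :
      Step band ⟨.store l (.val (.num n)) (.val v) :: is, cs, μ, ρ, U⟩ .retire .silent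
        ⟨is, cs, Function.update μ n (some v), ρ, U⟩
  | retireFail {is : List (Instr Var)} {cs : List (Cmd Var)} {μ : Mem} {ρ : VarMap Var}
      {U : Finset ℕ} {p : ℕ} :
      Step band ⟨.fail p :: is, cs, μ, ρ, U⟩ .retire (.fail p) ⟨[], [], μ, ρ, U⟩

/-! ### Complete executions under a valid schedule -/

/-- The number of stages of the execution of a fetched instruction: a `protect` first evaluates
its operand and later releases the value, every other instruction executes in a single step. -/
def Instr.stages {Var : Type*} : Instr Var → ℕ
  | .protect _ _ => 2
  | _ => 1

/-- `left` records, for each position of the reorder buffer `is`, how many execution stages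
remain of the instruction that was fetched there. A directive is admissible when it does not
execute an instruction again and does not retire a store that was never executed. (An
instruction with unresolved operands can only retire after its execution anyway, so the last
condition concerns only stores that are fetched with literal operands.) -/
def Admissible {Var : Type*} (left : List ℕ) (is : List (Instr Var)) : Directive → Prop
  | .exec n => ∃ k, left[n - 1]? = some (k + 1)
  | .retire => ∀ i, is.head? = some i → i.IsStore → left.head? = some 0
  | _ => True

/-- Update of the remaining stages after a step under a directive to the reorder buffer `is'`:
a newly fetched instruction enters with all its stages, execution consumes one stage (and a
rollback drops the squashed instructions), retirement drops the retired instruction (all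
instructions, for a failure). -/
def track {Var : Type*} (left : List ℕ) (is' : List (Instr Var)) : Directive → List ℕ
  | .exec n => (left.modify (n - 1) (fun k => k - 1)).take is'.length
  | .retire => left.tail.take is'.length
  | _ => left ++ (is'.drop left.length).map Instr.stages

/-- `ValidBigStep band left C D O C'`: the complete speculative execution (until reorder buffer
and command stack are empty) from `C` to `C'` that follows the schedule `D` and generates the
trace `O`, in which every fetched instruction is executed at most once, and stores are executed
before they retire. Initially, `left` is `[]` for an empty reorder buffer. -/
inductive ValidBigStep {Var : Type*} [DecidableEq Var] (band : ℕ → ℕ → ℕ) :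
    List ℕ → Config Var → List Directive → List Obs → Config Var → Prop where
  | done {left : List ℕ} {μ : Mem} {ρ : VarMap Var} {U : Finset ℕ} :
      ValidBigStep band left ⟨[], [], μ, ρ, U⟩ [] [] ⟨[], [], μ, ρ, U⟩
  | step {left : List ℕ} {C C' C'' : Config Var} {d : Directive} {D : List Directive} {o : Obs}
      {O : List Obs} :
      Step band C d o C' → Admissible left C.buf d →
      ValidBigStep band (track left C'.buf d) C' D O C'' →
      ValidBigStep band left C (d :: D) (o :: O) C''

/-! ### Filtering of speculative traces -/

/-- `p` identifies a mispredicted guard or a fail instruction of the trace `O`. -/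
def Squashing (O : List Obs) (p : ℕ) : Prop := Obs.rollback p ∈ O ∨ Obs.fail p ∈ O

open Classical in
/-- Filtering of one observation: rollbacks, and reads and writes that were issued while an
identifier in `P` was pending, become silent; all identifiers are removed. -/
noncomputable def filterObs (P : ℕ → Prop) : Obs → Option SeqObs
  | .silent => none
  | .rollback _ => none
  | .fail _ => some .fail
  | .read n ps => if ∃ p ∈ ps, P p then none else some (.read n)
  | .write n ps => if ∃ p ∈ ps, P p then none else some (.write n)

/-- Filtering of a trace. -/
noncomputable def filterTrace (O : List Obs) : List SeqObs := O.filterMap (filterObs (Squashing O))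

end SpecSem

open SpecSem

namespace SpecSem

/-! Every configuration has a sequential meaning, `Run`: evaluate the reorder buffer in order and
then the stack, except that a guard whose prediction is wrong continues with its recorded stack and
a failure stops. The initial configuration means the given sequential execution, and each processor
step transforms a `Run` into one with the same final memory and variables. At the end buffer and
stack are empty, so these finals are the actual ones. Derivations are carried forward, so
determinism is not needed.

The trace of a `Run` lists what remains to be observed. Executing a load turns it into an
assignment, so its read leaves the trace. An executed store stays in the buffer, so its write is
counted with multiplicity the remaining stages, which is 0 once it has been executed. Execution is
out of order, hence only a permutation.

Whether an observation is filtered depends on the future, and the list `B` predicts it. Its head,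
the first mispredicted guard or failure, is certain to be squashed; a used identifier outside `B`
never is; the other members of `B` may go either way. An observation carries the identifiers in
front of its instruction. If the head of `B` is among them, it is filtered and the sequential trace
is unaffected; otherwise they avoid `B`, and it accounts for one entry of the trace.

`Run.replace_tail` separates these two cases, `Step.sim` is the one-step simulation, and
`ValidBigStep.consistent` the induction. -/

variable {Var : Type*}

/-! ### Sequential meaning of stacks and buffers -/

/-- Sequential evaluation of a stack of commands. -/
inductive StackEval [DecidableEq Var] (band : ℕ → ℕ → ℕ) :
    List (Cmd Var) → Mem → VarMap Var → List SeqObs → Mem → VarMap Var → Prop where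
  | nil {μ : Mem} {ρ : VarMap Var} : StackEval band [] μ ρ [] μ ρ
  | cons {c : Cmd Var} {cs : List (Cmd Var)} {μ μ' μ'' : Mem} {ρ ρ' ρ'' : VarMap Var}
      {O₁ O₂ : List SeqObs} :
      SeqEval band c μ ρ O₁ μ' ρ' → SeqObs.fail ∉ O₁ → StackEval band cs μ' ρ' O₂ μ'' ρ'' →
      StackEval band (c :: cs) μ ρ (O₁ ++ O₂) μ'' ρ''
  | consFail {c : Cmd Var} {cs : List (Cmd Var)} {μ μ' : Mem} {ρ ρ' : VarMap Var}
      {O : List SeqObs} :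
      SeqEval band c μ ρ O μ' ρ' → SeqObs.fail ∈ O → StackEval band (c :: cs) μ ρ O μ' ρ'

/-- Sequential evaluation of a reorder buffer followed by a command stack. A guard whose
prediction is wrong continues with its recorded stack, and a store is observed once for each of
its remaining stages. The list `B` consists of the identifiers in the part of the buffer that
starts with the first mispredicted guard or failure. -/
inductive Run [DecidableEq Var] (band : ℕ → ℕ → ℕ) :
    List ℕ → List (Instr Var) → List (Cmd Var) → Mem → VarMap Var → List ℕ →
    List SeqObs → Mem → VarMap Var → Prop where
  | nil {cs : List (Cmd Var)} {μ μ' : Mem} {ρ ρ' : VarMap Var} {O : List SeqObs} :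
      StackEval band cs μ ρ O μ' ρ' → Run band [] [] cs μ ρ [] O μ' ρ'
  | nop {k : ℕ} {left : List ℕ} {is : List (Instr Var)} {cs : List (Cmd Var)} {μ μ' : Mem}
      {ρ ρ' : VarMap Var} {B : List ℕ} {O : List SeqObs} :
      Run band left is cs μ ρ B O μ' ρ' → Run band (k :: left) (.nop :: is) cs μ ρ B O μ' ρ'
  | fail {k : ℕ} {left : List ℕ} {is : List (Instr Var)} {cs : List (Cmd Var)} {μ : Mem}
      {ρ : VarMap Var} {p : ℕ} :
      Run band (k :: left) (.fail p :: is) cs μ ρ (p :: pendingIds is) [.fail] μ ρ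
  | asgn {k : ℕ} {left : List ℕ} {is : List (Instr Var)} {cs : List (Cmd Var)} {μ μ' : Mem}
      {ρ ρ' : VarMap Var} {B : List ℕ} {O : List SeqObs} {x : Var} {e : Expr Var} {v : Value} :
      eval band ρ.lift e = some v → Run band left is cs μ (Function.update ρ x v) B O μ' ρ' →
      Run band (k :: left) (.asgn x e :: is) cs μ ρ B O μ' ρ'
  | load {k : ℕ} {left : List ℕ} {is : List (Instr Var)} {cs : List (Cmd Var)} {μ μ' : Mem}
      {ρ ρ' : VarMap Var} {B : List ℕ} {O : List SeqObs} {x : Var} {l : Label} {e : Expr Var}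
      {n : ℕ} {v : Value} :
      eval band ρ.lift e = some (.num n) → μ n = some v →
      Run band left is cs μ (Function.update ρ x v) B O μ' ρ' →
      Run band (k :: left) (.load x l e :: is) cs μ ρ B (.read n :: O) μ' ρ'
  | store {k : ℕ} {left : List ℕ} {is : List (Instr Var)} {cs : List (Cmd Var)} {μ μ' : Mem}
      {ρ ρ' : VarMap Var} {B : List ℕ} {O : List SeqObs} {l : Label} {e₁ e₂ : Expr Var}
      {n : ℕ} {v : Value} :
      eval band ρ.lift e₁ = some (.num n) → eval band ρ.lift e₂ = some v →
      Run band left is cs (Function.update μ n (some v)) ρ B O μ' ρ' →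
      Run band (k :: left) (.store l e₁ e₂ :: is) cs μ ρ B
        (List.replicate k (.write n) ++ O) μ' ρ'
  | protect {k : ℕ} {left : List ℕ} {is : List (Instr Var)} {cs : List (Cmd Var)} {μ μ' : Mem}
      {ρ ρ' : VarMap Var} {B : List ℕ} {O : List SeqObs} {x : Var} {e : Expr Var} {v : Value} :
      eval band ρ.lift e = some v → Run band left is cs μ (Function.update ρ x v) B O μ' ρ' →
      Run band (k :: left) (.protect x e :: is) cs μ ρ B O μ' ρ'
  | guardOk {k : ℕ} {left : List ℕ} {is : List (Instr Var)} {cs cs' : List (Cmd Var)}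
      {μ μ' : Mem} {ρ ρ' : VarMap Var} {B : List ℕ} {O : List SeqObs} {e : Expr Var} {b : Bool}
      {p : ℕ} :
      eval band ρ.lift e = some (.bool b) → Run band left is cs μ ρ B O μ' ρ' →
      Run band (k :: left) (.guard e b cs' p :: is) cs μ ρ B O μ' ρ'
  | guardBad {k : ℕ} {left : List ℕ} {is : List (Instr Var)} {cs cs' : List (Cmd Var)}
      {μ μ' : Mem} {ρ ρ' : VarMap Var} {O : List SeqObs} {e : Expr Var} {b b' : Bool} {p : ℕ} :
      eval band ρ.lift e = some (.bool b') → b' ≠ b → StackEval band cs' μ ρ O μ' ρ' →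
      Run band (k :: left) (.guard e b cs' p :: is) cs μ ρ (p :: pendingIds is) O μ' ρ'

/-- The sequential observations that correspond to an observation that is not filtered. -/
def Obs.seqObs : Obs → List SeqObs
  | .silent => []
  | .fail _ => [.fail]
  | .read n _ => [.read n]
  | .write n _ => [.write n]
  | .rollback _ => []

/-- The identifiers that are attached to an observation. -/
def Obs.ids : Obs → List ℕ
  | .read _ ps => ps
  | .write _ ps => ps
  | _ => []

/-- The observation `o` squashes the instructions behind the identifier `p`. -/
def Obs.Squashes (o : Obs) (p : ℕ) : Prop := o = .rollback p ∨ o = .fail p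

/-! ### Order on transient variable maps -/

/-- `τ` is defined at most where `τ'` is, with the same values. -/
def TVarMap.Le (τ τ' : TVarMap Var) : Prop := ∀ x v, τ x = some v → τ' x = some v

/-- This is why early execution is sound: a value computed from partial information is the value
that in-order evaluation finds. -/
theorem eval_mono {band : ℕ → ℕ → ℕ} {τ τ' : TVarMap Var} (h : τ.Le τ') {e : Expr Var}
    {v : Value} (he : eval band τ e = some v) : eval band τ' e = some v := by
  induction e generalizing v with
  | val w => simpa [eval] using he
  | var x => exact h x v he
  | add e₁ e₂ ih₁ ih₂ | lt e₁ e₂ ih₁ ih₂ | band e₁ e₂ ih₁ ih₂ =>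
    simp only [eval] at he ⊢
    split at he
    · rename_i h₁ h₂
      rw [ih₁ h₁, ih₂ h₂]
      exact he
    · cases he
  | ite e₁ e₂ e₃ ih₁ ih₂ ih₃ =>
    simp only [eval] at he ⊢
    split at he
    · rename_i h₁
      rw [ih₁ h₁]
      exact ih₂ he
    · rename_i h₁
      rw [ih₁ h₁]
      exact ih₃ he
    · cases he
  | length e ih | base e ih =>
    simp only [eval] at he ⊢
    split at he
    · rename_i h₁
      rw [ih h₁]
      exact he
    · cases he

/-! ### Effect of execution on pending identifiers -/

theorem pendingIds_append (is₁ is₂ : List (Instr Var)) :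
    pendingIds (is₁ ++ is₂) = pendingIds is₁ ++ pendingIds is₂ := by
  induction is₁ with
  | nil => rfl
  | cons i is ih => cases i <;> simp [pendingIds, ih]

variable {band : ℕ → ℕ → ℕ}

theorem ExecInstr.pendingIds_sublist {μ : Mem} {τ : TVarMap Var} {is₁ is₂ is' : List (Instr Var)}
    {i : Instr Var} {cs cs' : List (Cmd Var)} {o : Obs}
    (h : ExecInstr band μ τ is₁ i is₂ cs o is' cs') :
    (pendingIds is').Sublist (pendingIds (is₁ ++ [i] ++ is₂)) := by
  cases h <;> simp [pendingIds_append, pendingIds]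

theorem ExecInstr.squashes {μ : Mem} {τ : TVarMap Var} {is₁ is₂ is' : List (Instr Var)}
    {i : Instr Var} {cs cs' : List (Cmd Var)} {o : Obs}
    (h : ExecInstr band μ τ is₁ i is₂ cs o is' cs')
    (hn : (pendingIds (is₁ ++ [i] ++ is₂)).Nodup) {p : ℕ} (ho : o.Squashes p) :
    p ∈ pendingIds (is₁ ++ [i] ++ is₂) ∧ p ∉ pendingIds is' := by
  cases h <;> simp only [Obs.Squashes, reduceCtorEq, or_self, Obs.rollback.injEq, or_false] at ho
  subst ho
  simp only [pendingIds_append, pendingIds, List.nodup_append, List.append_nil, List.mem_append,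
    List.mem_cons, List.not_mem_nil] at hn ⊢
  exact ⟨by simp, fun hp => hn.1.2.2 _ hp _ (by simp) rfl⟩

theorem ExecInstr.length_le {μ : Mem} {τ : TVarMap Var} {is₁ is₂ is' : List (Instr Var)}
    {i : Instr Var} {cs cs' : List (Cmd Var)} {o : Obs}
    (h : ExecInstr band μ τ is₁ i is₂ cs o is' cs') :
    is'.length ≤ (is₁ ++ [i] ++ is₂).length := by
  cases h <;> simp

variable [DecidableEq Var]

/-! ### Transient maps approximate sequential variable maps -/

theorem TVarMap.Le.update {τ τ' : TVarMap Var} (h : τ.Le τ') (x : Var) (o : Option Value) :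
    TVarMap.Le (Function.update τ x o) (Function.update τ' x o) := by
  intro y v
  by_cases hy : y = x
  · subst hy; simp
  · simpa [hy] using h y v

theorem TVarMap.lift_le_update (ρ : VarMap Var) (x : Var) (v : Value) :
    TVarMap.Le (Function.update ρ.lift x (some v)) (VarMap.lift (Function.update ρ x v)) := by
  intro y w
  by_cases hy : y = x
  · subst hy; simp [VarMap.lift]
  · simp [VarMap.lift, hy]

theorem TVarMap.update_none_le (ρ : VarMap Var) (x : Var) (v : Value) :
    TVarMap.Le (Function.update ρ.lift x none) (VarMap.lift (Function.update ρ x v)) := by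
  intro y w
  by_cases hy : y = x
  · subst hy; simp
  · simp [VarMap.lift, hy]

theorem TVarMap.Le.transient {τ τ' : TVarMap Var} (h : τ.Le τ') (is : List (Instr Var)) :
    TVarMap.Le (transient τ is) (transient τ' is) := by
  induction is generalizing τ τ' with
  | nil => exact h
  | cons i is ih =>
    cases i with
    | asgn x e => cases e <;> exact ih (h.update _ _)
    | load | protect => exact ih (h.update _ _)
    | _ => exact ih h

/-- A resolved assignment gives `x` its sequential value and an unresolved one makes `x` undefined;
both lie below the map after the assignment. -/
theorem transient_asgn_le {ρ : VarMap Var} {x : Var} {e : Expr Var} {v : Value}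
    (h : eval band ρ.lift e = some v) (is : List (Instr Var)) :
    TVarMap.Le (transient ρ.lift (.asgn x e :: is))
      (transient (VarMap.lift (Function.update ρ x v)) is) := by
  cases e with
  | val w =>
    obtain rfl : w = v := by simpa [eval] using h
    exact (TVarMap.lift_le_update ρ x w).transient is
  | _ => exact (TVarMap.update_none_le ρ x v).transient is

/-! ### Locality: changing a buffer behind a prefix -/

theorem Run.bad_subset {left : List ℕ} {is : List (Instr Var)} {cs : List (Cmd Var)}
    {μ μ' : Mem} {ρ ρ' : VarMap Var} {B : List ℕ} {O : List SeqObs}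
    (h : Run band left is cs μ ρ B O μ' ρ') : B ⊆ pendingIds is := by
  induction h with
  | guardOk _ _ ih => exact fun q hq => List.mem_cons_of_mem _ (ih hq)
  | nil => simp
  | fail | guardBad => simp [pendingIds]
  | _ => assumption

/-- Replacing the tail of the reorder buffer, and the command stack: either the prefix `is₁` is
evaluated completely, and the replacement has an effect, or it contains a mispredicted guard or
a failure. -/
theorem Run.replace_tail {left₁ L L' : List ℕ} {is₁ T T' : List (Instr Var)}
    {cs cs' : List (Cmd Var)} {τ : TVarMap Var} {M : Mem} {w : List SeqObs}
    {R : List ℕ → List ℕ → Prop} {μ μ' : Mem} {ρ ρ' : VarMap Var} {B : List ℕ} {O : List SeqObs}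
    (hlen : left₁.length = is₁.length) (hτ : τ.Le (transient ρ.lift is₁))
    (hM : (∀ i ∈ is₁, ¬ i.IsStore) → μ = M)
    (H : ∀ μ₁ ρ₁ B O, τ.Le ρ₁.lift → ((∀ i ∈ is₁, ¬ i.IsStore) → μ₁ = M) →
      Run band L T cs μ₁ ρ₁ B O μ' ρ' →
      ∃ B' O', Run band L' T' cs' μ₁ ρ₁ B' O' μ' ρ' ∧ R B B' ∧ O.Perm (w ++ O'))
    (h : Run band (left₁ ++ L) (is₁ ++ T) cs μ ρ B O μ' ρ') :
    (∃ B' O', Run band (left₁ ++ L') (is₁ ++ T') cs' μ ρ B' O' μ' ρ' ∧ R B B' ∧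
      O.Perm (w ++ O')) ∨
    ∃ p ∈ pendingIds is₁, ∃ B', B.head? = some p ∧ B'.head? = some p ∧
      Run band (left₁ ++ L') (is₁ ++ T') cs' μ ρ B' O μ' ρ' ∧
      (∀ q ∈ B', q ∈ B ∨ q ∈ pendingIds T') ∧ pendingIds T ⊆ B := by
  induction is₁ generalizing left₁ μ ρ B O M with
  | nil =>
    obtain rfl : left₁ = [] := by simpa using hlen
    exact .inl (H μ ρ B O hτ hM h)
  | cons j is ih =>
    obtain ⟨k, left, rfl⟩ : ∃ k l, left₁ = k :: l := by
      cases left₁ with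
      | nil => simp at hlen
      | cons k l => exact ⟨k, l, rfl⟩
    have hlen' : left.length = is.length := by simpa using hlen
    have H' : ¬ j.IsStore → ∀ μ₁ ρ₁ B O, τ.Le ρ₁.lift →
        ((∀ i ∈ is, ¬ i.IsStore) → μ₁ = M) → Run band L T cs μ₁ ρ₁ B O μ' ρ' →
        ∃ B' O', Run band L' T' cs' μ₁ ρ₁ B' O' μ' ρ' ∧ R B B' ∧ O.Perm (w ++ O') :=
      fun _ μ₁ ρ₁ B O h₁ h₂ => H μ₁ ρ₁ B O h₁ fun hs =>
        h₂ fun i hi => hs i (List.mem_cons_of_mem _ hi)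
    have hM' : ¬ j.IsStore → (∀ i ∈ is, ¬ i.IsStore) → μ = M := fun hj hs =>
      hM (by simpa [hj] using hs)
    simp only [List.cons_append] at h ⊢
    cases h with
    | nop h =>
      rcases ih hlen' hτ (hM' id) (H' id) h with ⟨B', O', h', hR, hO⟩ | ⟨p, hp, B', h₁, h₂, h₃, h₄⟩
      · exact .inl ⟨B', O', h'.nop, hR, hO⟩
      · exact .inr ⟨p, hp, B', h₁, h₂, h₃.nop, h₄⟩
    | @fail _ _ _ _ _ _ p =>
      refine .inr ⟨p, by simp [pendingIds], _, rfl, rfl, .fail, ?_, ?_⟩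
      · simp only [pendingIds_append, List.mem_cons, List.mem_append]
        tauto
      · intro q hq
        simp [pendingIds_append, hq]
    | asgn he h =>
      rcases ih hlen' (fun x v hx => transient_asgn_le he is x v (hτ x v hx)) (hM' id) (H' id) h
        with ⟨B', O', h', hR, hO⟩ | ⟨p, hp, B', h₁, h₂, h₃, h₄⟩
      · exact .inl ⟨B', O', h'.asgn he, hR, hO⟩
      · exact .inr ⟨p, hp, B', h₁, h₂, h₃.asgn he, h₄⟩
    | load he hμ h =>
      rcases ih hlen'
        (fun x v hx => (TVarMap.update_none_le ρ _ _).transient is x v (hτ x v hx))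
        (hM' id) (H' id) h
        with ⟨B', O', h', hR, hO⟩ | ⟨p, hp, B', h₁, h₂, h₃, h₄⟩
      · exact .inl ⟨B', _, h'.load he hμ, hR, (hO.cons _).trans List.perm_middle.symm⟩
      · exact .inr ⟨p, hp, B', h₁, h₂, h₃.load he hμ, h₄⟩
    | store he₁ he₂ h =>
      -- With a store in the prefix, the memory premise that `H` receives is vacuous, so `M` may be
      -- replaced by the updated memory.
      rcases ih (M := Function.update μ _ _) hlen' hτ (fun _ => rfl)
        (fun μ₁ ρ₁ B O h₁ _ => H μ₁ ρ₁ B O h₁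
          fun hs => (hs _ List.mem_cons_self trivial).elim) h
        with ⟨B', O', h', hR, hO⟩ | ⟨p, hp, B', h₁, h₂, h₃, h₄⟩
      · refine .inl ⟨B', _, h'.store he₁ he₂, hR, (hO.append_left _).trans ?_⟩
        simpa only [List.append_assoc] using List.perm_append_comm.append_right O'
      · exact .inr ⟨p, hp, B', h₁, h₂, h₃.store he₁ he₂, h₄⟩
    | protect he h =>
      rcases ih hlen'
        (fun x v hx => (TVarMap.update_none_le ρ _ _).transient is x v (hτ x v hx))
        (hM' id) (H' id) h
        with ⟨B', O', h', hR, hO⟩ | ⟨p, hp, B', h₁, h₂, h₃, h₄⟩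
      · exact .inl ⟨B', O', h'.protect he, hR, hO⟩
      · exact .inr ⟨p, hp, B', h₁, h₂, h₃.protect he, h₄⟩
    | guardOk he h =>
      rcases ih hlen' hτ (hM' id) (H' id) h with ⟨B', O', h', hR, hO⟩ | ⟨p, hp, B', h₁, h₂, h₃, h₄⟩
      · exact .inl ⟨B', O', h'.guardOk he, hR, hO⟩
      · exact .inr ⟨p, List.mem_cons_of_mem _ hp, B', h₁, h₂, h₃.guardOk he, h₄⟩
    | @guardBad _ _ _ _ _ _ _ _ _ _ _ _ _ p he hb h =>
      refine .inr ⟨p, by simp [pendingIds], _, rfl, rfl, .guardBad he hb h, ?_, ?_⟩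
      · simp only [pendingIds_append, List.mem_cons, List.mem_append]
        tauto
      · intro q hq
        simp [pendingIds_append, hq]

/-! ### Freshness of identifiers -/

/-- Bookkeeping invariant of the configurations of an execution. -/
structure WellFormed (left : List ℕ) (C : Config Var) : Prop where
  length_eq : left.length = C.buf.length
  nodup : (pendingIds C.buf).Nodup
  used : ∀ p ∈ pendingIds C.buf, p ∈ C.used

/-- The last two conclusions ensure that a squashed identifier never becomes pending again: new
identifiers are fresh, and a squashed one is used and gone. -/
theorem WellFormed.step {left : List ℕ} {C C' : Config Var} {d : Directive} {o : Obs}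
    (hC : WellFormed left C) (h : Step band C d o C') :
    WellFormed (track left C'.buf d) C' ∧ C.used ⊆ C'.used ∧
    (∀ p ∈ pendingIds C'.buf, p ∈ pendingIds C.buf ∨ p ∉ C.used) ∧
    ∀ p, o.Squashes p → p ∈ C.used ∧ p ∉ pendingIds C'.buf := by
  obtain ⟨hl, hn, hu⟩ := hC
  cases h with
  | execute hlen h =>
    dsimp only at hl hn hu ⊢
    have hs := h.pendingIds_sublist
    refine ⟨⟨?_, hn.sublist hs, fun p hp => hu p (hs.subset hp)⟩, subset_rfl,
      fun p hp => .inl (hs.subset hp), fun p hp => ?_⟩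
    · simpa [track, hl] using h.length_le
    · have := h.squashes hn hp
      exact ⟨hu p this.1, this.2⟩
  | retireFail =>
    refine ⟨⟨by simp [track], by simp [pendingIds], by simp [pendingIds]⟩, subset_rfl,
      by simp [pendingIds], fun p hp => ?_⟩
    simp only [Obs.Squashes, reduceCtorEq, Obs.fail.injEq, false_or] at hp
    subst hp
    exact ⟨hu _ (by simp [pendingIds]), by simp [pendingIds]⟩
  | fetchFail hp | fetchIfTrue hp | fetchIfFalse hp =>
    dsimp only at hl hn hu ⊢
    refine ⟨⟨by simp [track, hl], ?_, ?_⟩, Finset.subset_insert _ _, ?_,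
      by simp [Obs.Squashes]⟩
    · simp only [pendingIds_append, pendingIds]
      exact hn.append (by simp) (by simpa using fun h => hp (hu _ h))
    · simp only [pendingIds_append, pendingIds, List.mem_append, List.mem_singleton,
        Finset.mem_insert]
      rintro q (hq | rfl)
      exacts [.inr (hu q hq), .inl rfl]
    · simp only [pendingIds_append, pendingIds, List.mem_append, List.mem_singleton]
      rintro q (hq | rfl)
      exacts [.inl hq, .inr hp]
  | _ =>
    dsimp only at hl hn hu ⊢
    try simp only [pendingIds_append, pendingIds, List.append_nil] at hn hu ⊢
    refine ⟨⟨?_, by simpa [pendingIds_append, pendingIds] using hn,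
      by simpa [pendingIds_append, pendingIds] using hu⟩, subset_rfl, fun p hp => .inl hp,
      by simp [Obs.Squashes]⟩
    simp_all [track]

end SpecSem

namespace SpecSem

variable {Var : Type*} {band : ℕ → ℕ → ℕ}

/-! ### Filtering of single observations -/

theorem squashing_cons (o : Obs) (O : List Obs) (p : ℕ) :
    Squashing (o :: O) p ↔ o.Squashes p ∨ Squashing O p := by
  simp only [Squashing, Obs.Squashes, List.mem_cons, eq_comm (a := o)]
  tauto

theorem toList_filterObs_of_forall {P : ℕ → Prop} {o : Obs} (h : ∀ p ∈ o.ids, ¬ P p) :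
    (filterObs P o).toList = o.seqObs := by
  cases o <;> simp_all [filterObs, Obs.ids, Obs.seqObs]

theorem filterObs_eq_none {P : ℕ → Prop} {o : Obs}
    (h : o.seqObs = [] ∨ ∃ p ∈ o.ids, P p) : filterObs P o = none := by
  cases o <;> simp_all [filterObs, Obs.ids, Obs.seqObs]

theorem Obs.Squashes.ids_eq_nil {o : Obs} {p : ℕ} (h : o.Squashes p) : o.ids = [] := by
  rcases h with rfl | rfl <;> rfl

theorem eval_arr_bound {τ : TVarMap Var} {a : Arr} {e : Expr Var} {n : ℕ}
    (h : eval band τ e = some (.num n)) :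
    eval band τ (.lt e (.length (.val (.arr a)))) = some (.bool (decide (n < a.length))) := by
  simp [eval, h]

theorem eval_arr_address {τ : TVarMap Var} {a : Arr} {e : Expr Var} {n : ℕ}
    (h : eval band τ e = some (.num n)) :
    eval band τ (.add (.base (.val (.arr a))) e) = some (.num (a.base + n)) := by
  simp [eval, h]

variable [DecidableEq Var]

/-! ### Fetch-time rewriting of commands preserves evaluation -/

section StackEval

variable {cs : List (Cmd Var)} {μ μ' : Mem} {ρ ρ' : VarMap Var} {O : List SeqObs}

theorem StackEval.head_mono {c c' : Cmd Var}
    (hc : ∀ O μ' ρ', SeqEval band c μ ρ O μ' ρ' → SeqEval band c' μ ρ O μ' ρ')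
    (h : StackEval band (c :: cs) μ ρ O μ' ρ') : StackEval band (c' :: cs) μ ρ O μ' ρ' := by
  cases h with
  | cons h hf hs => exact .cons (hc _ _ _ h) hf hs
  | consFail h hf => exact .consFail (hc _ _ _ h) hf

theorem StackEval.seq {c₁ c₂ : Cmd Var} (h : StackEval band (.seq c₁ c₂ :: cs) μ ρ O μ' ρ') :
    StackEval band (c₁ :: c₂ :: cs) μ ρ O μ' ρ' := by
  cases h with
  | cons h hf hs =>
    cases h with
    | seq h₁ hf₁ h₂ =>
      rw [List.append_assoc]
      exact .cons h₁ hf₁ (.cons h₂ (by simp_all) hs)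
    | seqFail h₁ hf₁ => exact absurd hf₁ hf
  | consFail h hf =>
    cases h with
    | seq h₁ hf₁ h₂ => exact .cons h₁ hf₁ (.consFail h₂ (by simp_all))
    | seqFail h₁ hf₁ => exact .consFail h₁ hf₁

theorem StackEval.while {e : Expr Var} {c : Cmd Var}
    (h : StackEval band (.while e c :: cs) μ ρ O μ' ρ') :
    StackEval band (.ite e (.seq c (.while e c)) .skip :: cs) μ ρ O μ' ρ' := by
  refine h.head_mono fun O μ' ρ' h => ?_
  cases h with
  | whileTrue he h => exact .ite (b := true) he (by simpa using h)
  | whileFalse he => exact .ite (b := false) he (by simpa using .skip)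

theorem StackEval.arrRead {x : Var} {a : Arr} {e : Expr Var}
    (h : StackEval band (.asgn x (.arr a e) :: cs) μ ρ O μ' ρ') :
    StackEval band (.ite (.lt e (.length (.val (.arr a))))
      (.asgn x (.ptr a.label (.add (.base (.val (.arr a))) e))) .fail :: cs) μ ρ O μ' ρ' := by
  refine h.head_mono fun O μ' ρ' h => ?_
  cases h with
  | arrRead he hn hv =>
    exact .ite (eval_arr_bound he) (by simpa [hn] using .ptrRead (eval_arr_address he) hv)
  | arrReadFail he hn =>
    exact .ite (eval_arr_bound he) (by simpa [hn.not_gt] using .fail)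

theorem StackEval.arrWrite {a : Arr} {e₁ e₂ : Expr Var}
    (h : StackEval band (.arrWrite a e₁ e₂ :: cs) μ ρ O μ' ρ') :
    StackEval band (.ite (.lt e₁ (.length (.val (.arr a))))
      (.ptrWrite a.label (.add (.base (.val (.arr a))) e₁) e₂) .fail :: cs) μ ρ O μ' ρ' := by
  refine h.head_mono fun O μ' ρ' h => ?_
  cases h with
  | arrWrite he he₂ hn =>
    exact .ite (eval_arr_bound he) (by simpa [hn] using .ptrWrite (eval_arr_address he) he₂)
  | arrWriteFail he hn =>
    exact .ite (eval_arr_bound he) (by simpa [hn.not_gt] using .fail)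

/-- The extra `x := protect(x)` writes to `x` its own value, silently; after an abort it is not
reached. -/
theorem StackEval.protect {x : Var} {r : Rhs Var}
    (h : StackEval band (.protect x r :: cs) μ ρ O μ' ρ') :
    StackEval band (.asgn x r :: .protect x (.expr (.var x)) :: cs) μ ρ O μ' ρ' := by
  cases h with
  | @cons _ _ _ _ _ _ ρ₁ _ _ _ h hf hs =>
    cases h with
    | protect h =>
      refine .cons h hf ?_
      refine StackEval.cons (O₁ := []) (.protect (.asgn (v := ρ₁ x) rfl)) (by simp) ?_
      rwa [Function.update_eq_self]
  | consFail h hf =>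
    cases h with
    | protect h => exact .consFail h hf

theorem StackEval.ite {e : Expr Var} {c₁ c₂ : Cmd Var}
    (h : StackEval band (.ite e c₁ c₂ :: cs) μ ρ O μ' ρ') :
    ∃ b, eval band ρ.lift e = some (.bool b) ∧
      StackEval band ((if b then c₁ else c₂) :: cs) μ ρ O μ' ρ' := by
  cases h with
  | cons h hf hs =>
    cases h with
    | ite he h => exact ⟨_, he, .cons h hf hs⟩
  | consFail h hf =>
    cases h with
    | ite he h => exact ⟨_, he, .consFail h hf⟩

end StackEval

/-! ### Simulation of one processor step -/

/-- The configuration `C'` reached with observation `o` continues the sequential evaluation with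
trace `O` of a configuration with bad identifiers `B` and used identifiers `U`. -/
def StepSim (band : ℕ → ℕ → ℕ) (U : Finset ℕ) (B : List ℕ) (O : List SeqObs) (o : Obs)
    (left' : List ℕ) (C' : Config Var) (μ' : Mem) (ρ' : VarMap Var) : Prop :=
  ∃ B' O', Run band left' C'.buf C'.stack C'.mem C'.vars B' O' μ' ρ' ∧
    (∀ p ∈ B', p ∈ B ∨ p ∉ U) ∧
    (∀ p, B.head? = some p → B'.head? = some p ∨ o.Squashes p) ∧
    (∀ p, o.Squashes p → p ∈ B) ∧
    (O.Perm O' ∧ (o.seqObs = [] ∨ ∃ p ∈ o.ids, B'.head? = some p) ∨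
      O.Perm (o.seqObs ++ O') ∧ ∀ p ∈ o.ids, p ∉ B')

/-- Fetching replaces the empty tail of the buffer by `T`. If the buffer already contains a wrong
guard or a failure, the fetch is off the sequential path and changes at most `B`, by fresh
identifiers. -/
theorem Run.fetch {left : List ℕ} {is T : List (Instr Var)} {cs cs' : List (Cmd Var)}
    {U U' : Finset ℕ} {μ μ' : Mem} {ρ ρ' : VarMap Var} {B : List ℕ} {O : List SeqObs}
    (hl : left.length = is.length) (hT : ∀ p ∈ pendingIds T, p ∉ U)
    (H : ∀ μ ρ O, StackEval band cs μ ρ O μ' ρ' →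
      ∃ B', Run band (T.map Instr.stages) T cs' μ ρ B' O μ' ρ')
    (h : Run band left is cs μ ρ B O μ' ρ') :
    StepSim band U B O .silent (left ++ ((is ++ T).drop left.length).map Instr.stages)
      ⟨is ++ T, cs', μ, ρ, U'⟩ μ' ρ' := by
  have h' : Run band (left ++ []) (is ++ []) cs μ ρ B O μ' ρ' := by simpa using h
  rw [hl, List.drop_left]
  have H' : ∀ μ₁ ρ₁ B O, TVarMap.Le (transient ρ.lift is) ρ₁.lift →
      ((∀ i ∈ is, ¬ i.IsStore) → μ₁ = μ) → Run band [] [] cs μ₁ ρ₁ B O μ' ρ' →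
      ∃ B' O', Run band (T.map Instr.stages) T cs' μ₁ ρ₁ B' O' μ' ρ' ∧
        (B = [] ∧ B' ⊆ pendingIds T) ∧ O.Perm ([] ++ O') := by
    intro μ₁ ρ₁ B O _ _ h
    cases h with
    | nil h =>
      obtain ⟨B', hr⟩ := H _ _ _ h
      exact ⟨B', O, hr, ⟨rfl, hr.bad_subset⟩, .refl _⟩
  rcases h'.replace_tail (L' := T.map Instr.stages) (T' := T) (cs' := cs') (w := [])
    (R := fun B B' => B = [] ∧ B' ⊆ pendingIds T) hl (fun _ _ hx => hx) (fun _ => rfl) H' with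
    ⟨B', O', hr, ⟨hB, hB'⟩, hO⟩ | ⟨p, hp, B', h₁, h₂, hr, h₃, -⟩
  · exact ⟨B', O', hr, fun p hp => .inr (hT p (hB' hp)), by simp [hB], by simp [Obs.Squashes],
      .inr ⟨hO, by simp [Obs.ids]⟩⟩
  · refine ⟨B', O, hr, fun q hq => (h₃ q hq).imp_right (hT q), ?_, by simp [Obs.Squashes],
      .inr ⟨.refl _, by simp [Obs.ids]⟩⟩
    intro q hq
    rw [h₁] at hq
    exact .inl (h₂.trans hq)

theorem Run.fetch_nil {left : List ℕ} {is : List (Instr Var)} {cs cs' : List (Cmd Var)}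
    {U U' : Finset ℕ} {μ μ' : Mem} {ρ ρ' : VarMap Var} {B : List ℕ} {O : List SeqObs}
    (hl : left.length = is.length)
    (H : ∀ μ ρ O, StackEval band cs μ ρ O μ' ρ' → StackEval band cs' μ ρ O μ' ρ')
    (h : Run band left is cs μ ρ B O μ' ρ') :
    StepSim band U B O .silent (left ++ (is.drop left.length).map Instr.stages)
      ⟨is, cs', μ, ρ, U'⟩ μ' ρ' := by
  simpa using h.fetch (T := []) (U := U) (U' := U') (cs' := cs') hl (by simp [pendingIds])
    fun μ ρ O h => ⟨[], .nil (H μ ρ O h)⟩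

/-- Either prediction is harmless: the branch actually taken sits on the stack or in the guard. -/
theorem Run.guard_of_ite {k : ℕ} {cs : List (Cmd Var)} {μ μ' : Mem} {ρ ρ' : VarMap Var}
    {O : List SeqObs} {e : Expr Var} {c₁ c₂ : Cmd Var} (b : Bool) (p : ℕ)
    (h : StackEval band (.ite e c₁ c₂ :: cs) μ ρ O μ' ρ') :
    ∃ B, Run band [k] [.guard e b ((if b then c₂ else c₁) :: cs) p]
      ((if b then c₁ else c₂) :: cs) μ ρ B O μ' ρ' := by
  obtain ⟨b', he, hs⟩ := h.ite
  by_cases hb : b' = b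
  · subst hb
    exact ⟨_, .guardOk he (.nil hs)⟩
  · refine ⟨_, .guardBad he hb ?_⟩
    cases b <;> cases b' <;> simp_all

theorem Run.exec {left₁ left₂ : List ℕ} {k : ℕ} {is₁ is₂ is' : List (Instr Var)} {i : Instr Var}
    {cs cs' : List (Cmd Var)} {U U' : Finset ℕ} {μ μ' : Mem} {ρ ρ' : VarMap Var} {B : List ℕ}
    {O : List SeqObs} {o : Obs} (hl : left₁.length = is₁.length) (hl₂ : left₂.length = is₂.length)
    (hn : (pendingIds (is₁ ++ [i] ++ is₂)).Nodup)
    (he : ExecInstr band μ (transient ρ.lift is₁) is₁ i is₂ cs o is' cs')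
    (h : Run band (left₁ ++ (k + 1) :: left₂) (is₁ ++ [i] ++ is₂) cs μ ρ B O μ' ρ') :
    StepSim band U B O o ((left₁ ++ k :: left₂).take is'.length) ⟨is', cs', μ, ρ, U'⟩ μ' ρ' := by
  -- The effect of each instruction, assuming that evaluation reaches it with variables above the
  -- transient map.
  obtain ⟨L', T', rfl, hL', hT', hids, hsq, H⟩ : ∃ L' T', is' = is₁ ++ T' ∧
      (left₁ ++ k :: left₂).take is'.length = left₁ ++ L' ∧
      pendingIds T' ⊆ pendingIds (i :: is₂) ∧
      (o.ids = pendingIds is₁ ∨ o.ids = [] ∧ o.seqObs = []) ∧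
      (∀ p, o.Squashes p → p ∈ pendingIds (i :: is₂)) ∧
      ∀ μ₁ ρ₁ B O, TVarMap.Le (transient ρ.lift is₁) ρ₁.lift →
        ((∀ i ∈ is₁, ¬ i.IsStore) → μ₁ = μ) →
        Run band ((k + 1) :: left₂) (i :: is₂) cs μ₁ ρ₁ B O μ' ρ' →
        ∃ B' O', Run band L' T' cs' μ₁ ρ₁ B' O' μ' ρ' ∧
          (B ⊆ pendingIds (i :: is₂) ∧ B' ⊆ B ∧
            (∀ p, B.head? = some p → B'.head? = some p ∨ o.Squashes p) ∧
            (∀ p, o.Squashes p → p ∈ B)) ∧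
          O.Perm (o.seqObs ++ O') := by
    have htake : ∀ j : Instr Var, (left₁ ++ k :: left₂).take (is₁ ++ [j] ++ is₂).length =
        left₁ ++ k :: left₂ := fun j => List.take_of_length_le (by simp; omega)
    clear h
    cases he with
    | @asgn _ _ x _ v hv =>
      refine ⟨k :: left₂, .asgn x (.val v) :: is₂, by simp, htake _, by simp [pendingIds],
        .inr ⟨rfl, rfl⟩, by simp [Obs.Squashes], fun μ₁ ρ₁ B O hle _ h => ?_⟩
      have hB := h.bad_subset
      cases h with
      | asgn hv' h =>
        obtain rfl := Option.some.inj (hv'.symm.trans (eval_mono hle hv))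
        exact ⟨B, O, h.asgn rfl, ⟨hB, fun _ h => h, fun p hp => .inl hp, by simp [Obs.Squashes]⟩,
          .refl _⟩
    | @load _ _ x _ _ _ v hs hv hμ =>
      refine ⟨k :: left₂, .asgn x (.val v) :: is₂, by simp, htake _, by simp [pendingIds],
        .inl rfl, by simp [Obs.Squashes], fun μ₁ ρ₁ B O hle hM h => ?_⟩
      -- No store precedes the load, so the memory it reads is the one reached in order.
      obtain rfl := hM hs
      have hB := h.bad_subset
      cases h with
      | load hv' hμ' h =>
        obtain ⟨rfl⟩ := Option.some.inj (hv'.symm.trans (eval_mono hle hv))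
        obtain rfl := Option.some.inj (hμ'.symm.trans hμ)
        exact ⟨B, _, h.asgn rfl, ⟨hB, fun _ h => h, fun p hp => .inl hp, by simp [Obs.Squashes]⟩,
          .refl _⟩
    | @store _ _ l _ _ n v hv₁ hv₂ =>
      refine ⟨k :: left₂, .store l (.val (.num n)) (.val v) :: is₂, by simp, htake _,
        by simp [pendingIds], .inl rfl, by simp [Obs.Squashes], fun μ₁ ρ₁ B O hle _ h => ?_⟩
      have hB := h.bad_subset
      cases h with
      | store hv₁' hv₂' h =>
        obtain ⟨rfl⟩ := Option.some.inj (hv₁'.symm.trans (eval_mono hle hv₁))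
        obtain rfl := Option.some.inj (hv₂'.symm.trans (eval_mono hle hv₂))
        exact ⟨B, _, h.store rfl rfl,
          ⟨hB, fun _ h => h, fun p hp => .inl hp, by simp [Obs.Squashes]⟩, .refl _⟩
    | branchOk hv =>
      refine ⟨k :: left₂, .nop :: is₂, by simp, htake _, by simp [pendingIds],
        .inr ⟨rfl, rfl⟩, by simp [Obs.Squashes], fun μ₁ ρ₁ B O hle _ h => ?_⟩
      have hB := h.bad_subset
      cases h with
      | guardOk _ h =>
        exact ⟨B, O, h.nop, ⟨hB, fun _ h => h, fun p hp => .inl hp, by simp [Obs.Squashes]⟩,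
          .refl _⟩
      | guardBad hv' hb h =>
        obtain ⟨rfl⟩ := Option.some.inj (hv'.symm.trans (eval_mono hle hv))
        exact absurd rfl hb
    | branchMispredict hv hb =>
      refine ⟨[k], [.nop], rfl, ?_, by simp [pendingIds], .inr ⟨rfl, rfl⟩,
        by simp [Obs.Squashes, pendingIds], fun μ₁ ρ₁ B O hle _ h => ?_⟩
      · simp [List.take_append, ← hl, List.take_of_length_le]
      have hB := h.bad_subset
      cases h with
      | guardOk hv' h =>
        obtain ⟨rfl⟩ := Option.some.inj (hv'.symm.trans (eval_mono hle hv))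
        exact absurd rfl hb
      | guardBad _ _ h =>
        -- The rollback installs the stack that `Run` was already following, so nothing bad remains.
        exact ⟨[], O, .nop (.nil h), ⟨hB, by simp, by simp [Obs.Squashes],
          by simp [Obs.Squashes]⟩, .refl _⟩
    | @protect₁ _ _ x _ v hv =>
      refine ⟨k :: left₂, .protect x (.val v) :: is₂, by simp, htake _, by simp [pendingIds],
        .inr ⟨rfl, rfl⟩, by simp [Obs.Squashes], fun μ₁ ρ₁ B O hle _ h => ?_⟩
      have hB := h.bad_subset
      cases h with
      | protect hv' h =>
        obtain rfl := Option.some.inj (hv'.symm.trans (eval_mono hle hv))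
        exact ⟨B, O, h.protect rfl,
          ⟨hB, fun _ h => h, fun p hp => .inl hp, by simp [Obs.Squashes]⟩, .refl _⟩
    | @protect₂ _ _ x v _ =>
      refine ⟨k :: left₂, .asgn x (.val v) :: is₂, by simp, htake _, by simp [pendingIds],
        .inr ⟨rfl, rfl⟩, by simp [Obs.Squashes], fun μ₁ ρ₁ B O hle _ h => ?_⟩
      have hB := h.bad_subset
      cases h with
      | protect hv' h =>
        exact ⟨B, O, h.asgn hv', ⟨hB, fun _ h => h, fun p hp => .inl hp, by simp [Obs.Squashes]⟩,
          .refl _⟩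
  rw [hL']
  simp only [List.append_assoc, List.singleton_append] at h hn
  rcases h.replace_tail hl (fun _ _ hx => hx) (fun _ => rfl) H with
    ⟨B', O', hr, ⟨hB, hB', h₁, h₂⟩, hO⟩ | ⟨p, hp, B', h₁, h₂, hr, h₃, h₄⟩
  · refine ⟨B', O', hr, fun p hp => .inl (hB' hp), h₁, h₂, .inr ⟨hO, fun p hp hpB => ?_⟩⟩
    rw [pendingIds_append, List.nodup_append] at hn
    rcases hids with hids | ⟨hids, -⟩
    -- The observed identifiers lie before `i` and `B'` from `i` on; distinctness separates them.
    · exact hn.2.2 p (hids ▸ hp) p (hB (hB' hpB)) rfl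
    · simp [hids] at hp
  · refine ⟨B', O, hr, fun q hq => .inl ((h₃ q hq).elim id fun hq => h₄ (hT' hq)), ?_,
      fun q hq => h₄ (hsq q hq), .inl ⟨.refl _, ?_⟩⟩
    · intro q hq
      rw [h₁] at hq
      exact .inl (h₂.trans hq)
    · rcases hids with hids | ⟨-, hids⟩
      · exact .inr ⟨p, hids ▸ hp, h₂⟩
      · exact .inl hids

theorem StepSim.of_run {U : Finset ℕ} {left' : List ℕ} {C' : Config Var} {μ' : Mem}
    {ρ' : VarMap Var} {B : List ℕ} {O : List SeqObs}
    (h : Run band left' C'.buf C'.stack C'.mem C'.vars B O μ' ρ') :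
    StepSim band U B O .silent left' C' μ' ρ' :=
  ⟨B, O, h, fun _ hp => .inl hp, fun _ hp => .inl hp, by simp [Obs.Squashes],
    .inr ⟨.refl _, by simp [Obs.ids]⟩⟩

theorem Step.sim {left : List ℕ} {C C' : Config Var} {d : Directive} {o : Obs} {μ' : Mem}
    {ρ' : VarMap Var} {B : List ℕ} {O : List SeqObs} (hC : WellFormed left C)
    (hs : Step band C d o C') (ha : Admissible left C.buf d)
    (h : Run band left C.buf C.stack C.mem C.vars B O μ' ρ') :
    StepSim band C.used B O o (track left C'.buf d) C' μ' ρ' := by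
  obtain ⟨hl, hn, hu⟩ := hC
  cases hs with
  | fetchSkip =>
    refine h.fetch hl (by simp [pendingIds]) fun μ ρ O h => ⟨[], ?_⟩
    cases h with
    | cons h hf hs => cases h; exact .nop (.nil hs)
    | consFail h hf => cases h; simp at hf
  | @fetchFail _ _ _ _ _ p hp =>
    refine h.fetch hl (by simpa [pendingIds] using hp) fun μ ρ O h => ⟨[p], ?_⟩
    cases h with
    | cons h hf hs => cases h; simp at hf
    | consFail h hf => cases h; exact .fail
  | fetchAsgn =>
    refine h.fetch hl (by simp [pendingIds]) fun μ ρ O h => ⟨[], ?_⟩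
    cases h with
    | cons h hf hs => cases h with | asgn he => exact .asgn he (.nil hs)
    | consFail h hf => cases h; simp at hf
  | fetchPtrLoad =>
    refine h.fetch hl (by simp [pendingIds]) fun μ ρ O h => ⟨[], ?_⟩
    cases h with
    | cons h hf hs => cases h with | ptrRead he hv => exact .load he hv (.nil hs)
    | consFail h hf => cases h; simp at hf
  | fetchPtrStore =>
    refine h.fetch hl (by simp [pendingIds]) fun μ ρ O h => ⟨[], ?_⟩
    cases h with
    | cons h hf hs => cases h with | ptrWrite he he₂ => exact .store he he₂ (.nil hs)
    | consFail h hf => cases h; simp at hf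
  | fetchProtectExpr =>
    refine h.fetch hl (by simp [pendingIds]) fun μ ρ O h => ⟨[], ?_⟩
    cases h with
    | cons h hf hs =>
      cases h with | protect h => cases h with | asgn he => exact .protect he (.nil hs)
    | consFail h hf => cases h with | protect h => cases h; simp at hf
  | fetchSeq => exact h.fetch_nil hl fun _ _ _ h => h.seq
  | fetchArrLoad => exact h.fetch_nil hl fun _ _ _ h => h.arrRead
  | fetchArrStore => exact h.fetch_nil hl fun _ _ _ h => h.arrWrite
  | fetchWhile => exact h.fetch_nil hl fun _ _ _ h => h.while
  | fetchProtectPtr | fetchProtectArr => exact h.fetch_nil hl fun _ _ _ h => h.protect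
  | @fetchIfTrue _ _ _ _ _ _ _ _ p hp =>
    exact h.fetch hl (by simpa [pendingIds] using hp) fun μ ρ O h => Run.guard_of_ite true p h
  | @fetchIfFalse _ _ _ _ _ _ _ _ p hp =>
    exact h.fetch hl (by simpa [pendingIds] using hp) fun μ ρ O h => Run.guard_of_ite false p h
  | @execute is₁ is₂ _ i _ _ _ _ U n _ hlen he =>
    subst hlen
    obtain ⟨k, hk⟩ := ha
    rw [Nat.add_sub_cancel] at hk
    obtain ⟨hlt, hk⟩ := List.getElem?_eq_some_iff.1 hk
    have hleft : left = left.take is₁.length ++ (k + 1) :: left.drop (is₁.length + 1) := by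
      rw [← hk, List.getElem_cons_drop, List.take_append_drop]
    have hl₁ : (left.take is₁.length).length = is₁.length := by simp; omega
    have hl₂ : (left.drop (is₁.length + 1)).length = is₂.length := by
      simp [hl]; omega
    generalize left.take is₁.length = left₁ at *
    generalize left.drop (is₁.length + 1) = left₂ at *
    subst hleft
    have := h.exec (U := U) (U' := U) hl₁ hl₂ hn he
    have hm : (left₁ ++ (k + 1) :: left₂).modify left₁.length (fun k => k - 1) =
        left₁ ++ k :: left₂ := by simp [List.modify_eq_take_cons_drop]
    simpa [track, ← hl₁, hm] using this
  | retireNop =>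
    cases h with
    | nop h =>
      refine .of_run ?_
      rwa [track, List.tail_cons, List.take_of_length_le (by simpa using hl.le)]
  | retireAsgn =>
    cases h with
    | asgn he h =>
      obtain rfl := Option.some.inj he
      refine .of_run ?_
      rwa [track, List.tail_cons, List.take_of_length_le (by simpa using hl.le)]
  | retireStore =>
    cases h with
    | store he₁ he₂ h =>
      obtain ⟨rfl⟩ := Option.some.inj he₁
      obtain rfl := Option.some.inj he₂
      -- Admissibility leaves no stage, so no write of this store is still owed by the trace.
      obtain rfl := Option.some.inj (ha _ rfl trivial)
      refine .of_run ?_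
      rwa [track, List.tail_cons, List.take_of_length_le (by simpa using hl.le)]
  | retireFail =>
    cases h with
    | fail =>
      refine ⟨[], [], ?_, by simp, by simp [Obs.Squashes], by simp [Obs.Squashes],
        .inr ⟨.refl _, by simp [Obs.ids]⟩⟩
      simpa [track] using Run.nil .nil

/-! ### Induction over the execution -/

theorem Step.ids_subset {C C' : Config Var} {d : Directive} {o : Obs} (h : Step band C d o C') :
    o.ids ⊆ pendingIds C.buf := by
  cases h with
  | execute _ h => cases h <;> simp [Obs.ids, pendingIds_append]
  | _ => simp [Obs.ids]

/-- A complete execution agrees with the sequential evaluation of its initial configuration. The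
predicate `Past` stands for the identifiers that were squashed before. -/
theorem ValidBigStep.consistent {left : List ℕ} {C C' : Config Var} {D : List Directive}
    {Ob : List Obs} (h : ValidBigStep band left C D Ob C') {μ' : Mem} {ρ' : VarMap Var}
    {B : List ℕ} {O : List SeqObs} {Past : ℕ → Prop} (hC : WellFormed left C)
    (hr : Run band left C.buf C.stack C.mem C.vars B O μ' ρ')
    (hPast : ∀ p, Past p → p ∈ C.used ∧ p ∉ pendingIds C.buf) :
    μ' = C'.mem ∧ ρ' = C'.vars ∧ (∀ p, B.head? = some p → Squashing Ob p) ∧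
      (∀ p ∈ C.used, p ∉ B → ¬ Squashing Ob p) ∧
      O.Perm (Ob.filterMap (filterObs fun p => Past p ∨ Squashing Ob p)) := by
  induction h generalizing B O Past with
  | done =>
    cases hr with
    | nil hr => cases hr; simp [Squashing]
  | @step left C C' C'' d D o Ob hs ha _ ih =>
    obtain ⟨hC', hU, hids, hsq⟩ := hC.step hs
    obtain ⟨B', O', hr', hB, hhead, hBsq, hO⟩ := hs.sim hC ha hr
    -- The filter refers to the whole trace, so the tail must also be filtered by what `o` squashes.
    obtain ⟨hμ, hρ, hsome, hnone, hperm⟩ := ih (Past := fun p => Past p ∨ o.Squashes p) hC' hr' <| by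
      rintro p (hp | hp)
      · obtain ⟨h₁, h₂⟩ := hPast p hp
        exact ⟨hU h₁, fun h => (hids p h).elim h₂ fun h => h h₁⟩
      · exact ⟨hU (hsq p hp).1, (hsq p hp).2⟩
    refine ⟨hμ, hρ, fun p hp => ?_, fun p hp hpB => ?_, ?_⟩
    · rw [squashing_cons]
      exact (hhead p hp).symm.imp_right (hsome p)
    · rw [squashing_cons]
      rintro (h | h)
      · exact hpB (hBsq p h)
      · exact hnone p (hU hp) (fun h => (hB p h).elim hpB fun h => h hp) h
    · simp only [or_assoc] at hperm
      simp only [squashing_cons]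
      rcases hO with ⟨hO, ho⟩ | ⟨hO, ho⟩
      · rw [List.filterMap_cons_none]
        · exact hO.trans hperm
        · exact filterObs_eq_none
            (ho.imp_right fun ⟨p, hp, hpB⟩ => ⟨p, hp, .inr (.inr (hsome p hpB))⟩)
      · refine (hO.trans (hperm.append_left _)).trans ?_
        rw [← toList_filterObs_of_forall (P := fun p => Past p ∨ o.Squashes p ∨ Squashing Ob p)]
        · rw [List.filterMap_cons]
          split <;> simp_all
        -- An attached identifier is pending, so it was not squashed earlier; a squashing
        -- observation carries none; and lying outside `B'` excludes squashing later.
        · rintro p hp (h | h | h)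
          · exact (hPast p h).2 (hs.ids_subset hp)
          · simp [h.ids_eq_nil] at hp
          · exact hnone p (hU (hC.used p (hs.ids_subset hp))) (ho p hp) h

end SpecSem

open SpecSem
theorem theorem1 {Var : Type*} [DecidableEq Var] (band : ℕ → ℕ → ℕ)
    (c : Cmd Var) (μ μ' μ'' : Mem) (ρ ρ' ρ'' : VarMap Var) (O : List SeqObs)
    (D : List Directive) (O' : List Obs) (U : Finset ℕ)
    (hseq : SeqEval band c μ ρ O μ' ρ')
    (hspec : ValidBigStep band [] ⟨[], [c], μ, ρ, ∅⟩ D O' ⟨[], [], μ'', ρ'', U⟩) :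
    μ' = μ'' ∧ ρ' = ρ'' ∧ O.Perm (filterTrace O') := by
  have hstack : StackEval band [c] μ ρ O μ' ρ' := by
    by_cases hf : SeqObs.fail ∈ O
    · exact .consFail hseq hf
    · simpa using StackEval.cons hseq hf .nil
  obtain ⟨hμ, hρ, -, -, hO⟩ := hspec.consistent (Past := fun _ => False)
    ⟨rfl, by simp [pendingIds], by simp [pendingIds]⟩ (.nil hstack) (by simp)
  exact ⟨hμ, hρ, by simpa only [false_or, filterTrace] using hO⟩
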